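/- Let $m\ge 1$, $N=2m$, $0<q<1$, $\alpha>0$, and let $\Omega\subset\mathbb R^N$ be a bounded domain with $0\in\Omega$. Let $a:\Omega\to[0,\infty)$ be measurable and bounded, put $M_a(s)=\operatorname{meas}\{x\in\Omega: a(x)\le s\}$, and assume $$\int_0^1 s^{-1}M_a(s)\,(-\ln M_a(s))\,ds<+\infty$$ (with $0\ln 0=0$; the condition means that the positive part of the integrand is integrable). Set $\tilde a(x)=a(x)\exp(-1/|x|^{\alpha})$ for $x\ne0$, $\tilde a(0)=0$. For $v\in W_0^{m,2}(\Omega)$ (the closure of $C_c^m(\Omega)$ in $W^{m,2}(\Omega)$, real-valued functions) let $$\tilde F(v)=\int_\Omega\Big(|D_x^m v|^2+\tilde a(x)|v|^{1+q}\Big)dx,\qquad |D_x^m v|^2=\sum_{|\beta|=m}|D^\beta v|^2,$$ and for $h>0$ let $$\tilde\lambda_1(h)=\inf\{\tilde F(v): v\in W_0^{m,2}(\Omega),\ \|v\|_{L^2(\Omega)}^2=h\}.$$ Let $\widehat B(s)=(s+1)\ln(s+1)-s$ for $s\ge 0$, the complementary function of $B(t)=e^t-1-t$ in the sense of Orlicz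 spaces, and let $\widehat B^{-1}:[0,\infty)\to[0,\infty)$ be its inverse function. Then there exist $C>0$ and $h_0>0$ such that for every $h\in(0,h_0)$ and every $\tilde v_h\in W_0^{m,2}(\Omega)$ with $$\|\tilde v_h\|_{L^2(\Omega)}^2=h,\qquad \tilde\lambda_1(h)\le\tilde F(\tilde v_h)\le 2\tilde\lambda_1(h),$$ one has $$C\le\frac{\tilde\lambda_1(h)}{h}\left(\widehat B^{-1}\!\left(\Big(\operatorname{meas}\Big\{x\in\Omega:\ |\tilde v_h(x)|^{1-q}\,\frac{2\tilde\lambda_1(h)}{h}\ge\tilde a(x)\Big\}\Big)^{-1}\right)\right)^{-1}.$$ -/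

import Mathlib

open MeasureTheory Set Filter Topology
open scoped ContDiff

namespace FiniteExtinction

noncomputable section

/-! ### Partial derivatives and Sobolev spaces -/

/-- The list of directions `e₁, …, e₁, e₂, …, e₂, …` in which the coordinate vector `eᵢ` occurs
exactly `β i` times. -/
def directions {N : ℕ} (β : Fin N → ℕ) (k : Fin (∑ i, β i)) : EuclideanSpace ℝ (Fin N) :=
  EuclideanSpace.single (finSigmaFinEquiv.symm k).1 (1 : ℝ)

/-- The classical partial derivative `D^β φ` for a multi-index `β`. -/
def partialDeriv {N : ℕ} (β : Fin N → ℕ) (φ : EuclideanSpace ℝ (Fin N) → ℝ)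
    (x : EuclideanSpace ℝ (Fin N)) : ℝ :=
  iteratedFDeriv ℝ (∑ i, β i) φ x (directions β)

/-- `g` is a weak partial derivative `D^β v` of `v` on `Ω`, tested against `C_c^∞(Ω)`. -/
def HasWeakDeriv {N : ℕ} (Ω : Set (EuclideanSpace ℝ (Fin N))) (β : Fin N → ℕ)
    (v g : EuclideanSpace ℝ (Fin N) → ℝ) : Prop :=
  LocallyIntegrableOn v Ω ∧ LocallyIntegrableOn g Ω ∧
    ∀ φ : EuclideanSpace ℝ (Fin N) → ℝ, ContDiff ℝ ∞ φ → HasCompactSupport φ → tsupport φ ⊆ Ω →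
      ∫ x in Ω, v x * partialDeriv β φ x = (-1) ^ (∑ i, β i) * ∫ x in Ω, g x * φ x

open Classical in
/-- The weak partial derivative `D^β v` on `Ω` (unique up to a null set of the open set `Ω` when
it exists, and `0` by convention when it does not). -/
def weakDeriv {N : ℕ} (Ω : Set (EuclideanSpace ℝ (Fin N))) (β : Fin N → ℕ)
    (v : EuclideanSpace ℝ (Fin N) → ℝ) : EuclideanSpace ℝ (Fin N) → ℝ :=
  if h : ∃ g, HasWeakDeriv Ω β v g then h.choose else 0

/-- `v ∈ W^{m,2}(Ω)`: `v` is in `L²(Ω)` and has weak derivatives in `L²(Ω)` up to order `m`. -/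
def MemSobolev {N : ℕ} (m : ℕ) (Ω : Set (EuclideanSpace ℝ (Fin N)))
    (v : EuclideanSpace ℝ (Fin N) → ℝ) : Prop :=
  MemLp v 2 (volume.restrict Ω) ∧
    ∀ β : Fin N → ℕ, ∑ i, β i ≤ m →
      ∃ g, HasWeakDeriv Ω β v g ∧ MemLp g 2 (volume.restrict Ω)

/-- `v ∈ W_0^{m,2}(Ω)`: `v` is in the closure of `C_c^m(Ω)` in `W^{m,2}(Ω)`, that is, the weak
derivatives of `v` up to order `m` are simultaneously approximated in `L²(Ω)` by the derivatives
of compactly supported `C^m` functions. -/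
def MemSobolevZero {N : ℕ} (m : ℕ) (Ω : Set (EuclideanSpace ℝ (Fin N)))
    (v : EuclideanSpace ℝ (Fin N) → ℝ) : Prop :=
  MemSobolev m Ω v ∧
    ∀ ε : ENNReal, 0 < ε →
      ∃ φ : EuclideanSpace ℝ (Fin N) → ℝ,
        ContDiff ℝ m φ ∧ HasCompactSupport φ ∧ tsupport φ ⊆ Ω ∧
        ∀ β : Fin N → ℕ, ∑ i, β i ≤ m →
          eLpNorm (fun x => weakDeriv Ω β v x - partialDeriv β φ x) 2 (volume.restrict Ω) < ε

/-- `|D_x^m v(x)|²`, the sum of `(D^β v(x))²` over all multi-indices `β` of length `m`. -/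
def gradSq {N : ℕ} (m : ℕ) (Ω : Set (EuclideanSpace ℝ (Fin N)))
    (v : EuclideanSpace ℝ (Fin N) → ℝ) (x : EuclideanSpace ℝ (Fin N)) : ℝ :=
  ∑ β ∈ Finset.piAntidiag (Finset.univ : Finset (Fin N)) m, (weakDeriv Ω β v x) ^ 2

/-! ### The potential -/

/-- `M_a(s) = meas {x ∈ Ω : a(x) ≤ s}`. -/
def sublevelMeas {N : ℕ} (Ω : Set (EuclideanSpace ℝ (Fin N)))
    (a : EuclideanSpace ℝ (Fin N) → ℝ) (s : ℝ) : ℝ :=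
  volume.real {x ∈ Ω | a x ≤ s}

/-- `∫₀¹ s⁻¹ M_a(s) (-ln M_a(s)) ds < +∞` (with `0 ln 0 = 0`). The integrand may be negative where
`M_a(s) > 1`; only its positive part has to be integrable. -/
def LogDiniCondition {N : ℕ} (Ω : Set (EuclideanSpace ℝ (Fin N)))
    (a : EuclideanSpace ℝ (Fin N) → ℝ) : Prop :=
  ∫⁻ s in Ioo (0 : ℝ) 1,
    ENNReal.ofReal (s⁻¹ * sublevelMeas Ω a s * (-Real.log (sublevelMeas Ω a s))) < ⊤

open Classical in
/-- `ã(x) = a(x) exp(-1/|x|^α)`, extended by its limit `0` at the origin. -/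
def modifiedPotential {N : ℕ} (α : ℝ) (a : EuclideanSpace ℝ (Fin N) → ℝ)
    (x : EuclideanSpace ℝ (Fin N)) : ℝ :=
  if x = 0 then 0 else a x * Real.exp (-(1 / ‖x‖ ^ α))

/-! ### The nonlinear Schrödinger functional and its almost-minimizers -/

/-- `∫_Ω (|D_x^m v|² + b(x) |v|^{1+q}) dx`. -/
def energy {N : ℕ} (m : ℕ) (q : ℝ) (Ω : Set (EuclideanSpace ℝ (Fin N)))
    (b v : EuclideanSpace ℝ (Fin N) → ℝ) : ℝ :=
  ∫ x in Ω, (gradSq m Ω v x + b x * |v x| ^ (1 + q))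

/-- The infimum of the energy over `v ∈ W_0^{m,2}(Ω)` with `‖v‖²_{L²(Ω)} = h`. -/
def firstEigenvalue {N : ℕ} (m : ℕ) (q : ℝ) (Ω : Set (EuclideanSpace ℝ (Fin N)))
    (b : EuclideanSpace ℝ (Fin N) → ℝ) (h : ℝ) : ℝ :=
  sInf {r : ℝ | ∃ v : EuclideanSpace ℝ (Fin N) → ℝ,
    MemSobolevZero m Ω v ∧ ∫ x in Ω, (v x) ^ 2 = h ∧ r = energy m q Ω b v}

/-- `v ∈ W_0^{m,2}(Ω)` with `‖v‖²_{L²(Ω)} = h` whose energy is between the infimum and twice the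
infimum. -/
structure IsAlmostMinimizer {N : ℕ} (m : ℕ) (q : ℝ) (Ω : Set (EuclideanSpace ℝ (Fin N)))
    (b : EuclideanSpace ℝ (Fin N) → ℝ) (h : ℝ) (v : EuclideanSpace ℝ (Fin N) → ℝ) : Prop where
  mem : MemSobolevZero m Ω v
  normSq_eq : ∫ x in Ω, (v x) ^ 2 = h
  le_energy : firstEigenvalue m q Ω b h ≤ energy m q Ω b v
  energy_le : energy m q Ω b v ≤ 2 * firstEigenvalue m q Ω b h

/-! ### The Orlicz functions -/

/-- `B(t) = e^t - 1 - t`. -/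
def orliczB (t : ℝ) : ℝ := Real.exp t - 1 - t

/-- `B̂(s) = (s + 1) ln (s + 1) - s`. -/
def orliczBhat (s : ℝ) : ℝ := (s + 1) * Real.log (s + 1) - s

/-- `A` and `A'` are complementary functions on `[0, ∞)`: `A(t) = ∫₀ᵗ a` and `A'(t) = ∫₀ᵗ a⁻¹`
for an increasing bijection `a` of `[0, ∞)` with inverse function `a⁻¹`. -/
def AreComplementary (A A' : ℝ → ℝ) : Prop :=
  ∃ a b : ℝ → ℝ, StrictMonoOn a (Ici 0) ∧ MapsTo a (Ici 0) (Ici 0) ∧ MapsTo b (Ici 0) (Ici 0) ∧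
    InvOn b a (Ici 0) (Ici 0) ∧
    (∀ t, 0 ≤ t → A t = ∫ τ in (0 : ℝ)..t, a τ) ∧ (∀ t, 0 ≤ t → A' t = ∫ τ in (0 : ℝ)..t, b τ)

theorem areComplementary_orliczB : AreComplementary orliczB orliczBhat := by
  refine ⟨fun t => Real.exp t - 1, fun s => Real.log (s + 1), ?_, ?_, ?_, ⟨?_, ?_⟩, ?_, ?_⟩
  · intro x _ y _ hxy
    have := Real.exp_lt_exp.2 hxy
    simpa using this
  · intro x hx
    have := Real.one_le_exp (mem_Ici.1 hx)
    simpa using this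
  · intro x hx
    have hx' := mem_Ici.1 hx
    exact Real.log_nonneg (by linarith)
  · intro x _
    simp
  · intro x hx
    have hx' := mem_Ici.1 hx
    have : Real.exp (Real.log (x + 1)) = x + 1 := Real.exp_log (by linarith)
    simp [this]
  · intro t _
    rw [intervalIntegral.integral_sub (Real.continuous_exp.intervalIntegrable _ _)
      (continuous_const.intervalIntegrable _ _)]
    simp [orliczB]
  · intro t _
    rw [intervalIntegral.integral_comp_add_right (fun x => Real.log x) 1, integral_log]
    simp [orliczBhat]
    ring

/-- `B̂` is a bijection of `[0, ∞)`, so that its inverse function below is well defined. -/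
theorem bijOn_orliczBhat : BijOn orliczBhat (Ici 0) (Ici 0) := by
  have hd : ∀ s : ℝ, 0 ≤ s → HasDerivAt orliczBhat (Real.log (s + 1)) s := by
    intro s hs
    have h1 : HasDerivAt (fun s : ℝ => s + 1) 1 s := (hasDerivAt_id s).add_const 1
    have h2 := ((h1.mul (h1.log (by linarith))).sub (hasDerivAt_id s))
    have h3 : (s + 1) * (1 / (s + 1)) = 1 := mul_one_div_cancel (by linarith)
    refine h2.congr_deriv ?_
    rw [h3]
    ring
  have hc : ContinuousOn orliczBhat (Ici 0) := fun s hs =>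
    (hd s hs).continuousAt.continuousWithinAt
  have hm : StrictMonoOn orliczBhat (Ici 0) := by
    refine strictMonoOn_of_deriv_pos (convex_Ici 0) hc ?_
    intro s hs
    rw [interior_Ici, mem_Ioi] at hs
    rw [(hd s hs.le).deriv]
    exact Real.log_pos (by linarith)
  have h0 : orliczBhat 0 = 0 := by simp [orliczBhat]
  refine ⟨?_, hm.injOn, ?_⟩
  · intro s hs
    have := hm.monotoneOn self_mem_Ici hs (mem_Ici.1 hs)
    rw [h0] at this
    exact this
  · intro y hy
    have hy' := mem_Ici.1 hy
    set T : ℝ := Real.exp (y + 2) - 1 with hT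
    have h1 : y + 2 + 1 ≤ Real.exp (y + 2) := Real.add_one_le_exp _
    have hT0 : 0 ≤ T := by linarith
    have hB : y ≤ orliczBhat T := by
      have hlog : Real.log (T + 1) = y + 2 := by simp [hT]
      rw [orliczBhat, hlog]
      nlinarith
    obtain ⟨s, hs, hsy⟩ := intermediate_value_Icc hT0 (hc.mono Icc_subset_Ici_self)
      (⟨by rw [h0]; exact hy', hB⟩ : y ∈ Icc (orliczBhat 0) (orliczBhat T))
    exact ⟨s, hs.1, hsy⟩

/-- The inverse function `B̂⁻¹ : [0, ∞) → [0, ∞)`. -/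
def orliczBhatInv (y : ℝ) : ℝ := Function.invFunOn orliczBhat (Ici 0) y

end

end FiniteExtinction

open FiniteExtinction

namespace FiniteExtinction

open scoped FourierTransform SchwartzMap ComplexConjugate

/-! ### The Cauchy–Schwarz inequality for real integrals -/

/-! Put `c = 2λ/h` and let `E` be the set where the potential is at most `c|v|^{1-q}`. Off `E` the
potential term is at least `c v²`, while the whole energy is at most `2λ = c∫_Ω v²`. Subtracting
leaves `∫_Ω |D^m v|² ≤ c ∫_E v²` (`integral_gradSq_le_of_energy_le`).

In the critical dimension `N = 2m` a function in `W_0^{m,2}` is almost bounded: `∫_E v² ≤ K τ(|E|)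
∫_Ω |D^m v|²` with `τ(t) = t(1 + ln(1 + 1/t))` (`exists_setIntegral_sq_le_gradSq`). For `t ≤ |Ω|`,
`τ(t)` is at most a constant times `1/B̂⁻¹(1/t)` (`exists_mul_log_le_inv_orliczBhatInv`). Chaining
the three bounds and cancelling `∫_Ω |D^m v|² > 0` gives the claim.

The embedding is proved on the Fourier side instead of through Orlicz duality. With `g = 1_E f`,
Plancherel turns `∫_E |f|²` into the pairing of `ĝ` and `f̂`. For `|ξ| < R` one uses `|ĝ| ≤
|E|^{1/2} ‖f‖_{L²(E)}`; for `|ξ| ≥ R` the factor `R^{-m}|ξ|^m ≥ 1` brings in the derivatives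
(`sqrt_setIntegral_sq_le`). The low-frequency integral of `|f̂|` costs the square root of a
logarithm, because `|ξ|^{-2m}` is borderline non-integrable in dimension `2m`
(`setIntegral_ball_norm_le`). Taking `R` comparable to `(1 + 1/|E|)^{1/(2m)}` balances the two
pieces. -/

theorem integral_mul_le_sqrt_mul_sqrt {X : Type*} [MeasurableSpace X] {μ : Measure X}
    {u v : X → ℝ} (hu0 : ∀ x, 0 ≤ u x) (hv0 : ∀ x, 0 ≤ v x) (hu : MemLp u 2 μ) (hv : MemLp v 2 μ) :
    ∫ x, u x * v x ∂μ ≤ √(∫ x, u x ^ 2 ∂μ) * √(∫ x, v x ^ 2 ∂μ) := by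
  have h := integral_mul_le_Lp_mul_Lq_of_nonneg (μ := μ) Real.HolderConjugate.two_two
    (Eventually.of_forall hu0) (Eventually.of_forall hv0) (by simpa using hu) (by simpa using hv)
  simpa [Real.sqrt_eq_rpow] using h

theorem setIntegral_le_sqrt_mul_sqrt {X : Type*} [MeasurableSpace X] {μ : Measure X} {s : Set X}
    (hs : μ s ≠ ⊤) {v : X → ℝ} (hv0 : ∀ x, 0 ≤ v x) (hv : MemLp v 2 (μ.restrict s)) :
    ∫ x in s, v x ∂μ ≤ √(μ.real s) * √(∫ x in s, v x ^ 2 ∂μ) := by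
  have : IsFiniteMeasure (μ.restrict s) := ⟨by simpa using hs.lt_top⟩
  have h := integral_mul_le_sqrt_mul_sqrt (μ := μ.restrict s) (u := fun _ => 1) (v := v)
    (fun _ => zero_le_one) hv0 (memLp_const 1) hv
  simpa using h

/-! ### Plancherel's theorem for integrable square-integrable functions -/

section Fourier

variable {V : Type*} [NormedAddCommGroup V] [InnerProductSpace ℝ V] [FiniteDimensional ℝ V]
  [MeasurableSpace V] [BorelSpace V]

theorem continuous_fourier {f : V → ℂ} (hf : Integrable f) : Continuous (𝓕 f) :=
  VectorFourier.fourierIntegral_continuous Real.continuous_fourierChar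
    (by exact continuous_inner) hf

theorem norm_fourier_le (f : V → ℂ) (ξ : V) : ‖𝓕 f ξ‖ ≤ ∫ x, ‖f x‖ :=
  VectorFourier.norm_fourierIntegral_le_integral_norm _ _ _ _ _

theorem integral_fourier_mul {f g : V → ℂ} (hf : Integrable f) (hg : Integrable g) :
    ∫ ξ, 𝓕 f ξ * g ξ = ∫ x, f x * 𝓕 g x := by
  have h := VectorFourier.integral_fourierIntegral_smul_eq_flip (L := innerₗ V)
    (μ := volume) (ν := volume) Real.continuous_fourierChar continuous_inner hf hg
  rw [flip_innerₗ] at h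
  exact h

/-- The Fourier transform on `L²` is given by the Fourier integral on `L¹ ∩ L²`. -/
theorem coeFn_fourier_toLp {f : V → ℂ} (hf1 : Integrable f) (hf2 : MemLp f 2) :
    ((𝓕 (hf2.toLp f) : Lp ℂ 2 (volume : Measure V)) : V → ℂ) =ᵐ[volume] 𝓕 f := by
  -- It suffices to pair with real test functions. The `L²` transform agrees with the distributional
  -- one, so it can be moved onto the test function and back onto `f` by the multiplication formula.
  refine ae_eq_of_integral_contDiff_smul_eq
    ((Lp.memLp _).locallyIntegrable (by norm_num)) (continuous_fourier hf1).locallyIntegrable ?_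
  intro g hg hgc
  have hgc' : HasCompactSupport (fun x => (g x : ℂ)) := hgc.comp_left (g := Complex.ofReal) rfl
  have hg' : ContDiff ℝ ∞ (fun x => (g x : ℂ)) := Complex.ofRealCLM.contDiff.comp hg
  let G : 𝓢(V, ℂ) := hgc'.toSchwartzMap hg'
  have hG : ∀ x, G x = (g x : ℂ) := fun x => rfl
  have h1 : ∫ x, G x • ((𝓕 (hf2.toLp f) : Lp ℂ 2 (volume : Measure V)) : V → ℂ) x
      = ∫ x, (𝓕 G) x • (hf2.toLp f : V → ℂ) x := by
    rw [← Lp.toTemperedDistribution_apply, ← Lp.fourier_toTemperedDistribution_eq,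
      TemperedDistribution.fourier_apply, Lp.toTemperedDistribution_apply]
  have h2 : ∫ x, (𝓕 G) x • (hf2.toLp f : V → ℂ) x = ∫ x, (𝓕 G) x • f x := by
    refine integral_congr_ae ?_
    filter_upwards [hf2.coeFn_toLp] with x hx
    rw [hx]
  have h3 : ∫ x, (𝓕 G) x • f x = ∫ x, G x * 𝓕 f x := by
    rw [← integral_fourier_mul G.integrable hf1]
    rfl
  simp only [Complex.real_smul]
  exact h1.trans (h2.trans h3)

theorem memLp_fourier {f : V → ℂ} (hf1 : Integrable f) (hf2 : MemLp f 2) : MemLp (𝓕 f) 2 :=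
  (memLp_congr_ae (coeFn_fourier_toLp hf1 hf2)).1 (Lp.memLp _)

theorem integral_conj_mul_fourier {f g : V → ℂ} (hf1 : Integrable f) (hf2 : MemLp f 2)
    (hg1 : Integrable g) (hg2 : MemLp g 2) :
    ∫ ξ, 𝓕 g ξ * conj (𝓕 f ξ) = ∫ x, g x * conj (f x) := by
  have h := Lp.inner_fourier_eq (hf2.toLp f) (hg2.toLp g)
  rw [L2.inner_def, L2.inner_def] at h
  have h1 : ∫ ξ, 𝓕 g ξ * conj (𝓕 f ξ) = ∫ ξ, inner ℂ ((𝓕 (hf2.toLp f) : Lp ℂ 2 (volume : Measure V)) ξ)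
      ((𝓕 (hg2.toLp g) : Lp ℂ 2 (volume : Measure V)) ξ) := by
    refine integral_congr_ae ?_
    filter_upwards [coeFn_fourier_toLp hf1 hf2, coeFn_fourier_toLp hg1 hg2] with ξ h1 h2
    rw [h1, h2, RCLike.inner_apply]
  have h2 : ∫ x, g x * conj (f x) = ∫ x, inner ℂ ((hf2.toLp f) x) ((hg2.toLp g) x) := by
    refine integral_congr_ae ?_
    filter_upwards [hf2.coeFn_toLp, hg2.coeFn_toLp] with ξ h1 h2
    rw [h1, h2, RCLike.inner_apply]
  rw [h1, h2, h]

theorem integral_norm_sq_fourier {f : V → ℂ} (hf1 : Integrable f) (hf2 : MemLp f 2) :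
    ∫ ξ, ‖𝓕 f ξ‖ ^ 2 = ∫ x, ‖f x‖ ^ 2 := by
  have h := integral_conj_mul_fourier hf1 hf2 hf1 hf2
  simp only [Complex.mul_conj, Complex.normSq_eq_norm_sq] at h
  rw [integral_complex_ofReal, integral_complex_ofReal] at h
  exact_mod_cast h

/-- Splitting the frequencies at radius `R` bounds the `L²` norm of `f` on `E` by the low
frequencies times `|E|^{1/2}` plus the `L²` norm of the high frequencies. -/
theorem sqrt_setIntegral_sq_le {f : V → ℂ} (hf1 : Integrable f) (hf2 : MemLp f 2) {m : ℕ}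
    (hfm : MemLp (fun ξ => ‖ξ‖ ^ m * ‖𝓕 f ξ‖) 2) {E : Set V} (hE : MeasurableSet E)
    (hEf : volume E ≠ ⊤) {R : ℝ} (hR : 0 < R) :
    √(∫ x in E, ‖f x‖ ^ 2) ≤ √(volume.real E) * (∫ ξ in Metric.ball (0 : V) R, ‖𝓕 f ξ‖)
      + (R ^ m)⁻¹ * √(∫ ξ, (‖ξ‖ ^ m * ‖𝓕 f ξ‖) ^ 2) := by
  set g : V → ℂ := E.indicator f with hg
  set I : ℝ := ∫ x in E, ‖f x‖ ^ 2 with hI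
  have hg1 : Integrable g := hf1.indicator hE
  have hg2 : MemLp g 2 := hf2.indicator hE
  have hI0 : 0 ≤ I := integral_nonneg fun x => by positivity
  have hgI : ∫ x, ‖g x‖ ^ 2 = I := by
    rw [hI, ← integral_indicator hE]
    congr 1
    ext x
    by_cases hx : x ∈ E <;> simp [hg, hx]
  have hgs : ∫ x, ‖g x‖ ≤ √(volume.real E) * √I := by
    have h := setIntegral_le_sqrt_mul_sqrt hEf (fun x => norm_nonneg (f x)) (hf2.restrict E).norm
    have h' : ∫ x, ‖g x‖ = ∫ x in E, ‖f x‖ := by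
      rw [← integral_indicator hE]
      congr 1
      ext x
      by_cases hx : x ∈ E <;> simp [hg, hx]
    rw [h']
    exact h
  have hFf := memLp_fourier hf1 hf2
  have hFg := memLp_fourier hg1 hg2
  have hprod : Integrable (fun ξ => ‖𝓕 g ξ‖ * ‖𝓕 f ξ‖) := hFg.norm.integrable_mul hFf.norm
  -- Since `g` is `f` cut off to `E`, `I` is the inner product of `g` and `f`, and Plancherel moves
  -- it to the frequency side.
  have hI1 : I ≤ ∫ ξ, ‖𝓕 g ξ‖ * ‖𝓕 f ξ‖ := by
    have h1 : ((I : ℝ) : ℂ) = ∫ x, g x * conj (f x) := by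
      rw [← hgI, ← integral_complex_ofReal]
      congr 1
      ext x
      by_cases hx : x ∈ E <;> simp [hg, hx, Complex.mul_conj, Complex.normSq_eq_norm_sq]
    have h2 : I = ‖∫ ξ, 𝓕 g ξ * conj (𝓕 f ξ)‖ := by
      rw [integral_conj_mul_fourier hf1 hf2 hg1 hg2, ← h1]
      simp [abs_of_nonneg hI0]
    rw [h2]
    refine (norm_integral_le_integral_norm _).trans (le_of_eq ?_)
    simp
  have hball : ∫ ξ in Metric.ball (0 : V) R, ‖𝓕 g ξ‖ * ‖𝓕 f ξ‖
      ≤ (√(volume.real E) * √I) * ∫ ξ in Metric.ball (0 : V) R, ‖𝓕 f ξ‖ := by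
    rw [← integral_const_mul]
    have hint : IntegrableOn (fun ξ => ‖𝓕 f ξ‖) (Metric.ball (0 : V) R) :=
      ((continuous_fourier hf1).norm.continuousOn.integrableOn_compact
        (isCompact_closedBall (0 : V) R)).mono_set Metric.ball_subset_closedBall
    refine integral_mono hprod.integrableOn (hint.const_mul _) fun ξ => ?_
    exact mul_le_mul_of_nonneg_right ((norm_fourier_le g ξ).trans hgs) (norm_nonneg _)
  have hcompl : ∫ ξ in (Metric.ball (0 : V) R)ᶜ, ‖𝓕 g ξ‖ * ‖𝓕 f ξ‖
      ≤ (R ^ m)⁻¹ * (√I * √(∫ ξ, (‖ξ‖ ^ m * ‖𝓕 f ξ‖) ^ 2)) := by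
    have hcs := integral_mul_le_sqrt_mul_sqrt (fun ξ => norm_nonneg (𝓕 g ξ))
      (fun ξ => by positivity) hFg.norm hfm
    rw [integral_norm_sq_fourier hg1 hg2, hgI] at hcs
    have hint : Integrable (fun ξ => ‖𝓕 g ξ‖ * (‖ξ‖ ^ m * ‖𝓕 f ξ‖)) := hFg.norm.integrable_mul hfm
    refine le_trans ?_ (mul_le_mul_of_nonneg_left hcs (by positivity))
    rw [← integral_const_mul]
    refine le_trans (setIntegral_mono_on hprod.integrableOn (hint.const_mul _).integrableOn
      measurableSet_ball.compl fun ξ hξ => ?_) (setIntegral_le_integral (hint.const_mul _)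
        (Eventually.of_forall fun ξ => by positivity))
    have hξ' : R ≤ ‖ξ‖ := by simpa using hξ
    have h1 : 1 ≤ (R ^ m)⁻¹ * ‖ξ‖ ^ m := by
      rw [inv_mul_eq_div, one_le_div (by positivity)]
      exact pow_le_pow_left₀ hR.le hξ' m
    calc ‖𝓕 g ξ‖ * ‖𝓕 f ξ‖ = 1 * (‖𝓕 g ξ‖ * ‖𝓕 f ξ‖) := (one_mul _).symm
      _ ≤ ((R ^ m)⁻¹ * ‖ξ‖ ^ m) * (‖𝓕 g ξ‖ * ‖𝓕 f ξ‖) :=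
        mul_le_mul_of_nonneg_right h1 (by positivity)
      _ = _ := by ring
  have hsplit := integral_add_compl (measurableSet_ball (x := (0 : V)) (ε := R)) hprod
  -- Both frequency ranges contribute a factor `√I`, which is cancelled when it is positive.
  rcases hI0.eq_or_lt with h0 | hpos
  · rw [← h0, Real.sqrt_zero]
    have : 0 ≤ ∫ ξ in Metric.ball (0 : V) R, ‖𝓕 f ξ‖ := integral_nonneg fun _ => norm_nonneg _
    positivity
  · have hs : 0 < √I := Real.sqrt_pos.2 hpos
    have hss : √I * √I = I := Real.mul_self_sqrt hI0
    refine le_of_mul_le_mul_left ?_ hs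
    rw [hss]
    linarith

end Fourier

/-! ### Low frequencies in dimension `2m` -/

section LowFrequency

variable {V : Type*} [NormedAddCommGroup V] [InnerProductSpace ℝ V] [FiniteDimensional ℝ V]
  [MeasurableSpace V] [BorelSpace V]

/-- In dimension `2m` the integral of `|ξ|^{-2m}` over an annulus is logarithmic. -/
theorem integral_annulus {m : ℕ} (hm : 1 ≤ m) (hV : Module.finrank ℝ V = 2 * m) {δ R : ℝ}
    (hδ : 0 < δ) (hδR : δ ≤ R) :
    ∫ ξ : V, (Ico δ R).indicator (fun y : ℝ => (y ^ (2 * m))⁻¹) ‖ξ‖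
      = (2 * m : ℕ) * (volume : Measure V).real (Metric.ball 0 1) * Real.log (R / δ) := by
  have : Nontrivial V := Module.nontrivial_of_finrank_pos (R := ℝ) (by omega)
  rw [integral_fun_norm_addHaar, hV]
  -- In polar coordinates the surface factor `y^{2m-1}` reduces `y^{-2m}` to `1/y`.
  have h : ∫ y in Ioi (0 : ℝ), y ^ (2 * m - 1) • (Ico δ R).indicator (fun y : ℝ => (y ^ (2 * m))⁻¹) y
      = Real.log (R / δ) := by
    rw [← integral_inv_of_pos hδ (hδ.trans_le hδR), intervalIntegral.integral_of_le hδR,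
      ← integral_Ico_eq_integral_Ioc, ← integral_indicator measurableSet_Ioi,
      ← integral_indicator measurableSet_Ico]
    congr 1
    ext y
    by_cases hy : y ∈ Ico δ R
    · have hy0 : 0 < y := hδ.trans_le hy.1
      have hpow : y ^ (2 * m) = y ^ (2 * m - 1) * y := by
        rw [← pow_succ]
        congr 1
        omega
      rw [indicator_of_mem (mem_Ioi.2 hy0), indicator_of_mem hy, indicator_of_mem hy, smul_eq_mul,
        hpow]
      field_simp
    · rw [indicator_of_notMem hy]
      exact indicator_apply_eq_zero.2 fun _ => by simp only [indicator_of_notMem hy, smul_zero]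
  rw [h]
  simp only [nsmul_eq_mul, smul_eq_mul]
  ring

/-- On the annulus `δ ≤ |ξ| < R`, Cauchy–Schwarz against the weight `|ξ|^{-m}` produces the
logarithm. That weight is not square integrable at the origin, so the ball of radius `δ` is handled
by the sup bound `M`. -/
theorem setIntegral_ball_norm_le {m : ℕ} (hm : 1 ≤ m) (hV : Module.finrank ℝ V = 2 * m)
    {F : V → ℂ} (hF : Continuous F) {M : ℝ} (hM : ∀ ξ, ‖F ξ‖ ≤ M)
    (hFm : MemLp (fun ξ => ‖ξ‖ ^ m * ‖F ξ‖) 2) {δ R : ℝ} (hδ : 0 < δ) (hδR : δ ≤ R) :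
    ∫ ξ in Metric.ball (0 : V) R, ‖F ξ‖ ≤ M * (volume : Measure V).real (Metric.ball 0 δ)
      + √((2 * m : ℕ) * (volume : Measure V).real (Metric.ball 0 1) * Real.log (R / δ))
        * √(∫ ξ, (‖ξ‖ ^ m * ‖F ξ‖) ^ 2) := by
  set S : Set V := {ξ | ‖ξ‖ ∈ Ico δ R} with hS
  have hSm : MeasurableSet S := measurable_norm measurableSet_Ico
  have hint : ∀ r, IntegrableOn (fun ξ => ‖F ξ‖) (Metric.ball (0 : V) r) := fun r =>
    (hF.norm.continuousOn.integrableOn_compact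
        (isCompact_closedBall (0 : V) r)).mono_set Metric.ball_subset_closedBall
  have hSR : S ⊆ Metric.ball 0 R := fun ξ hξ => by simpa using hξ.2
  have hun : Metric.ball (0 : V) R = Metric.ball 0 δ ∪ S := by
    ext ξ
    simp only [Metric.mem_ball, dist_zero_right, mem_union, hS, mem_ofPred_eq, mem_Ico]
    constructor
    · intro h
      rcases lt_or_ge ‖ξ‖ δ with h' | h'
      · exact Or.inl h'
      · exact Or.inr ⟨h', h⟩
    · rintro (h | h)
      · exact h.trans_le hδR
      · exact h.2
  have hdisj : Disjoint (Metric.ball (0 : V) δ) S := by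
    rw [Set.disjoint_left]
    intro ξ h1 h2
    have h1' : ‖ξ‖ < δ := by simpa using h1
    exact absurd h2.1 (not_le.2 h1')
  rw [hun, setIntegral_union hdisj hSm (hint δ) ((hint R).mono_set hSR)]
  refine add_le_add ?_ ?_
  · have h := norm_setIntegral_le_of_norm_le_const (μ := volume) (s := Metric.ball (0 : V) δ)
      (f := fun ξ => ‖F ξ‖) (C := M) Metric.isBounded_ball.measure_lt_top (fun ξ _ => by simpa using hM ξ)
    exact (le_abs_self _).trans h
  · set k : V → ℝ := S.indicator (fun ξ => (‖ξ‖ ^ m)⁻¹) with hk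
    have hk0 : ∀ ξ, 0 ≤ k ξ := fun ξ => indicator_nonneg (fun _ _ => by positivity) ξ
    have hkm : Measurable k := (by fun_prop : Measurable fun ξ : V => (‖ξ‖ ^ m)⁻¹).indicator hSm
    have hk2 : ∀ ξ, k ξ ^ 2 = (Ico δ R).indicator (fun y : ℝ => (y ^ (2 * m))⁻¹) ‖ξ‖ := by
      intro ξ
      by_cases hξ : ξ ∈ S
      · rw [hk, indicator_of_mem hξ, indicator_of_mem (show ‖ξ‖ ∈ Ico δ R from hξ), inv_pow,
          ← pow_mul, mul_comm m 2]
      · rw [hk, indicator_of_notMem hξ, indicator_of_notMem (show ‖ξ‖ ∉ Ico δ R from hξ)]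
        simp
    have hkL : MemLp k 2 := by
      have hbd : MemLp (S.indicator fun _ => (δ ^ m)⁻¹) 2 (volume : Measure V) :=
        memLp_indicator_const 2 hSm _ (Or.inr
          ((measure_mono hSR).trans_lt Metric.isBounded_ball.measure_lt_top).ne)
      refine hbd.mono hkm.aestronglyMeasurable (Eventually.of_forall fun ξ => ?_)
      by_cases hξ : ξ ∈ S
      · rw [hk, indicator_of_mem hξ, indicator_of_mem hξ]
        have hd : δ ≤ ‖ξ‖ := hξ.1
        rw [Real.norm_of_nonneg (by positivity), Real.norm_of_nonneg (by positivity)]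
        gcongr
      · rw [hk, indicator_of_notMem hξ, indicator_of_notMem hξ]
    have hcs := integral_mul_le_sqrt_mul_sqrt hk0 (fun ξ => by positivity) hkL hFm
    simp only [hk2] at hcs
    rw [integral_annulus hm hV hδ hδR] at hcs
    refine le_trans (le_of_eq ?_) hcs
    rw [← integral_indicator hSm]
    congr 1
    ext ξ
    by_cases hξ : ξ ∈ S
    · have h0 : 0 < ‖ξ‖ := hδ.trans_le hξ.1
      rw [hk, indicator_of_mem hξ, indicator_of_mem hξ]
      field_simp
    · rw [hk, indicator_of_notMem hξ, indicator_of_notMem hξ, zero_mul]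

end LowFrequency

/-! ### The Fourier transform of the derivatives of `C_c^m` functions -/

theorem partialDeriv_single {N m : ℕ} (i : Fin N) (φ : EuclideanSpace ℝ (Fin N) → ℝ)
    (x : EuclideanSpace ℝ (Fin N)) :
    partialDeriv (Pi.single i m) φ x
      = iteratedFDeriv ℝ m φ x (fun _ => EuclideanSpace.single i (1 : ℝ)) := by
  have hdir : directions (Pi.single i m : Fin N → ℕ) = fun _ => EuclideanSpace.single i (1 : ℝ) := by
    ext1 k
    have hj : (finSigmaFinEquiv.symm k).1 = i := by
      by_contra hne
      have h2 := (finSigmaFinEquiv.symm k).2.isLt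
      exact Nat.not_lt_zero _ (h2.trans_eq (Pi.single_eq_of_ne (M := fun _ => ℕ) hne m))
    rw [directions, hj]
  have hsum : ∑ j, (Pi.single i m : Fin N → ℕ) j = m := by simp
  rw [partialDeriv, hdir]
  -- The order of differentiation equals `m` only propositionally, so it is generalised before
  -- substituting.
  generalize ∑ j, (Pi.single i m : Fin N → ℕ) j = n at hsum
  subst hsum
  rfl

theorem continuous_partialDeriv {N m : ℕ} {φ : EuclideanSpace ℝ (Fin N) → ℝ}
    (hφ : ContDiff ℝ m φ) {β : Fin N → ℕ} (hβ : ∑ i, β i ≤ m) : Continuous (partialDeriv β φ) := by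
  have h := hφ.continuous_iteratedFDeriv (m := ∑ i, β i) (by exact_mod_cast hβ)
  exact (ContinuousMultilinearMap.apply ℝ (fun _ => EuclideanSpace ℝ (Fin N)) ℝ
    (directions β)).continuous.comp h

theorem support_partialDeriv_subset {N : ℕ} (β : Fin N → ℕ) (φ : EuclideanSpace ℝ (Fin N) → ℝ) :
    Function.support (partialDeriv β φ) ⊆ tsupport φ := by
  intro x hx
  refine support_iteratedFDeriv_subset (𝕜 := ℝ) (∑ i, β i) ?_
  intro h0
  refine hx ?_
  simp [partialDeriv, h0]

theorem hasCompactSupport_partialDeriv {N : ℕ} (β : Fin N → ℕ)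
    {φ : EuclideanSpace ℝ (Fin N) → ℝ} (hφ : HasCompactSupport φ) :
    HasCompactSupport (partialDeriv β φ) :=
  hφ.mono' (support_partialDeriv_subset β φ)

theorem integrable_and_memLp_ofReal {V : Type*} [NormedAddCommGroup V] [MeasurableSpace V] [BorelSpace V]
    {μ : Measure V} [IsFiniteMeasureOnCompacts μ] {f : V → ℝ} (hf : Continuous f)
    (hfc : HasCompactSupport f) :
    Integrable (fun x => (f x : ℂ)) μ ∧ MemLp (fun x => (f x : ℂ)) 2 μ := by
  have h1 : Continuous fun x => (f x : ℂ) := Complex.continuous_ofReal.comp hf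
  have h2 : HasCompactSupport fun x => (f x : ℂ) := hfc.comp_left (g := Complex.ofReal) rfl
  exact ⟨h1.integrable_of_hasCompactSupport h2, h1.memLp_of_hasCompactSupport h2⟩

theorem norm_fourier_partialDeriv_single {N m : ℕ} (i : Fin N)
    {φ : EuclideanSpace ℝ (Fin N) → ℝ} (hφ : ContDiff ℝ m φ) (hφc : HasCompactSupport φ)
    (ξ : EuclideanSpace ℝ (Fin N)) :
    ‖𝓕 (fun x => (partialDeriv (Pi.single i m) φ x : ℂ)) ξ‖
      = (2 * Real.pi * |ξ i|) ^ m * ‖𝓕 (fun x => (φ x : ℂ)) ξ‖ := by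
  have hφ' : ContDiff ℝ m (fun x => (φ x : ℂ)) := Complex.ofRealCLM.contDiff.comp hφ
  have hφc' : HasCompactSupport (fun x => (φ x : ℂ)) := hφc.comp_left (g := Complex.ofReal) rfl
  have hint : ∀ n : ℕ, (n : ℕ∞) ≤ (m : ℕ∞) →
      Integrable (iteratedFDeriv ℝ n (fun x => (φ x : ℂ))) := fun n hn =>
    (hφ'.continuous_iteratedFDeriv (by exact_mod_cast hn)).integrable_of_hasCompactSupport
      (hφc'.iteratedFDeriv n)
  have h := Real.fourier_iteratedFDeriv (N := (m : ℕ∞)) (by exact_mod_cast hφ') hint le_rfl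
  have h1 : (fun x => (partialDeriv (Pi.single i m) φ x : ℂ))
      = fun x => iteratedFDeriv ℝ m (fun x => (φ x : ℂ)) x
        (fun _ => EuclideanSpace.single i (1 : ℝ)) := by
    ext x
    rw [partialDeriv_single]
    have := Complex.ofRealCLM.iteratedFDeriv_comp_left (f := φ) (x := x) hφ.contDiffAt (i := m) le_rfl
    have h3 := congrArg (fun T => T (fun _ => EuclideanSpace.single i (1 : ℝ))) this
    exact h3.symm
  rw [h1, ← Real.fourier_continuousMultilinearMap_apply (hint m le_rfl), h,
    VectorFourier.fourierPowSMulRight_apply]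
  have hin : innerSL ℝ ξ (EuclideanSpace.single i (1 : ℝ)) = ξ i := by
    rw [innerSL_apply_apply, EuclideanSpace.inner_single_right]
    simp
  have hin' : ((-innerSL ℝ) ξ : EuclideanSpace ℝ (Fin N) →L[ℝ] ℝ)
      (EuclideanSpace.single i (1 : ℝ)) = - ξ i := by
    rw [← hin]
    rfl
  simp only [hin']
  simp [abs_of_pos Real.pi_pos, mul_pow, mul_assoc]

/-- The largest coordinate carries at least `1/N` of `|ξ|²`. Hence the pure derivatives `∂_i^m`
control `|ξ|^m` and mixed derivatives are not needed. -/
theorem norm_sq_pow_le_sum {N : ℕ} (hN : 1 ≤ N) (m : ℕ) (ξ : EuclideanSpace ℝ (Fin N)) :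
    (‖ξ‖ ^ m) ^ 2 ≤ (N : ℝ) ^ m * ∑ i, (|ξ i| ^ m) ^ 2 := by
  have : Nonempty (Fin N) := ⟨⟨0, hN⟩⟩
  obtain ⟨i, -, hi⟩ := Finset.exists_max_image Finset.univ (fun i => |ξ i|) Finset.univ_nonempty
  have h1 : ‖ξ‖ ^ 2 ≤ N * |ξ i| ^ 2 := by
    rw [EuclideanSpace.real_norm_sq_eq]
    calc ∑ j, ξ j ^ 2 ≤ ∑ _j : Fin N, |ξ i| ^ 2 := by
          refine Finset.sum_le_sum fun j _ => ?_
          rw [← sq_abs (ξ j)]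
          exact pow_le_pow_left₀ (abs_nonneg _) (hi j (Finset.mem_univ j)) 2
      _ = N * |ξ i| ^ 2 := by simp
  calc (‖ξ‖ ^ m) ^ 2 = (‖ξ‖ ^ 2) ^ m := by rw [← pow_mul, ← pow_mul, mul_comm]
    _ ≤ (N * |ξ i| ^ 2) ^ m := pow_le_pow_left₀ (by positivity) h1 m
    _ = (N : ℝ) ^ m * (|ξ i| ^ m) ^ 2 := by
      rw [mul_pow, ← pow_mul, ← pow_mul, mul_comm 2 m]
    _ ≤ (N : ℝ) ^ m * ∑ j, (|ξ j| ^ m) ^ 2 := by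
      gcongr
      exact Finset.single_le_sum (f := fun j => (|ξ j| ^ m) ^ 2) (fun j _ => by positivity)
        (Finset.mem_univ i)

theorem sqrt_sum_le_sum_sqrt {ι : Type*} (s : Finset ι) {u : ι → ℝ} (hu : ∀ i, 0 ≤ u i) :
    √(∑ i ∈ s, u i) ≤ ∑ i ∈ s, √(u i) := by
  refine Real.sqrt_le_iff.2 ⟨Finset.sum_nonneg fun i _ => Real.sqrt_nonneg _, ?_⟩
  calc ∑ i ∈ s, u i = ∑ i ∈ s, √(u i) ^ 2 :=
        Finset.sum_congr rfl fun i _ => (Real.sq_sqrt (hu i)).symm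
    _ ≤ _ := Finset.sum_sq_le_sq_sum_of_nonneg fun i _ => Real.sqrt_nonneg _

theorem memLp_norm_pow_mul_fourier {N m : ℕ} (hN : 1 ≤ N)
    {φ : EuclideanSpace ℝ (Fin N) → ℝ} (hφ : ContDiff ℝ m φ) (hφc : HasCompactSupport φ) :
    MemLp (fun ξ => ‖ξ‖ ^ m * ‖𝓕 (fun x => (φ x : ℂ)) ξ‖) 2 ∧
      √(∫ ξ, (‖ξ‖ ^ m * ‖𝓕 (fun x => (φ x : ℂ)) ξ‖) ^ 2)
        ≤ √((N : ℝ) ^ m) * ∑ i, √(∫ x, partialDeriv (Pi.single i m) φ x ^ 2) := by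
  set F := 𝓕 (fun x => (φ x : ℂ)) with hF
  have hφL := integrable_and_memLp_ofReal (μ := volume) hφ.continuous hφc
  have hFc : Continuous F := continuous_fourier hφL.1
  have hcont : ∀ i, Continuous (partialDeriv (Pi.single i m) φ) := fun i =>
    continuous_partialDeriv hφ (by simp)
  have hdL := fun i => integrable_and_memLp_ofReal (μ := volume) (hcont i)
    (hasCompactSupport_partialDeriv (Pi.single i m) hφc)
  have hle : ∀ i ξ, |ξ i| ^ m * ‖F ξ‖
      ≤ ‖𝓕 (fun x => (partialDeriv (Pi.single i m) φ x : ℂ)) ξ‖ := by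
    intro i ξ
    rw [norm_fourier_partialDeriv_single i hφ hφc ξ]
    refine mul_le_mul_of_nonneg_right (pow_le_pow_left₀ (abs_nonneg _) ?_ m) (norm_nonneg _)
    -- The factor `2π ≥ 1` from the Fourier symbol is discarded.
    nlinarith [Real.pi_gt_three, abs_nonneg (ξ i)]
  have hiL : ∀ i : Fin N, MemLp (fun ξ : EuclideanSpace ℝ (Fin N) => |ξ i| ^ m * ‖F ξ‖) 2 := by
    intro i
    refine (memLp_fourier (hdL i).1 (hdL i).2).mono ?_ (Eventually.of_forall fun ξ => ?_)
    · exact (by fun_prop : Continuous fun ξ : EuclideanSpace ℝ (Fin N) =>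
        |ξ i| ^ m * ‖F ξ‖).aestronglyMeasurable
    · rw [Real.norm_of_nonneg (by positivity)]
      exact hle i ξ
  have hii : ∀ i : Fin N, ∫ ξ : EuclideanSpace ℝ (Fin N), (|ξ i| ^ m * ‖F ξ‖) ^ 2
      ≤ ∫ x, partialDeriv (Pi.single i m) φ x ^ 2 := by
    intro i
    have h1 : ∫ x, partialDeriv (Pi.single i m) φ x ^ 2
        = ∫ ξ, ‖𝓕 (fun x => (partialDeriv (Pi.single i m) φ x : ℂ)) ξ‖ ^ 2 := by
      rw [integral_norm_sq_fourier (hdL i).1 (hdL i).2]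
      simp
    rw [h1]
    exact integral_mono (hiL i).integrable_sq
      (memLp_fourier (hdL i).1 (hdL i).2).norm.integrable_sq fun ξ =>
        pow_le_pow_left₀ (by positivity) (hle i ξ) 2
  have hpt : ∀ ξ : EuclideanSpace ℝ (Fin N), (‖ξ‖ ^ m * ‖F ξ‖) ^ 2
      ≤ (N : ℝ) ^ m * ∑ i, (|ξ i| ^ m * ‖F ξ‖) ^ 2 := by
    intro ξ
    have h := mul_le_mul_of_nonneg_right (norm_sq_pow_le_sum hN m ξ) (sq_nonneg ‖F ξ‖)
    simpa only [mul_pow, Finset.sum_mul, mul_assoc, Finset.mul_sum] using h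
  have hsumI : Integrable fun ξ : EuclideanSpace ℝ (Fin N) =>
      (N : ℝ) ^ m * ∑ i, (|ξ i| ^ m * ‖F ξ‖) ^ 2 :=
    (integrable_finsetSum _ fun i _ => (hiL i).integrable_sq).const_mul _
  have hmeas : Continuous fun ξ : EuclideanSpace ℝ (Fin N) => ‖ξ‖ ^ m * ‖F ξ‖ := by fun_prop
  have hint : Integrable fun ξ : EuclideanSpace ℝ (Fin N) => (‖ξ‖ ^ m * ‖F ξ‖) ^ 2 :=
    hsumI.mono (hmeas.pow 2).aestronglyMeasurable (Eventually.of_forall fun ξ => by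
      rw [Real.norm_of_nonneg (by positivity), Real.norm_of_nonneg (by positivity)]
      exact hpt ξ)
  refine ⟨(memLp_two_iff_integrable_sq hmeas.aestronglyMeasurable).2 hint, ?_⟩
  have h2 : ∫ ξ, (‖ξ‖ ^ m * ‖F ξ‖) ^ 2
      ≤ (N : ℝ) ^ m * ∑ i, ∫ x, partialDeriv (Pi.single i m) φ x ^ 2 := by
    refine (integral_mono hint hsumI hpt).trans ?_
    rw [integral_const_mul, integral_finsetSum _ fun i _ => (hiL i).integrable_sq]
    exact mul_le_mul_of_nonneg_left (Finset.sum_le_sum fun i _ => hii i) (by positivity)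
  refine (Real.sqrt_le_sqrt h2).trans ?_
  rw [Real.sqrt_mul (by positivity)]
  gcongr
  exact sqrt_sum_le_sum_sqrt _ fun i => integral_nonneg fun x => sq_nonneg _

theorem setIntegral_eq_integral_of_tsupport_subset {V : Type*} [TopologicalSpace V]
    [MeasurableSpace V] {μ : Measure V} {Ω : Set V} {φ u : V → ℝ} (hφ : tsupport φ ⊆ Ω)
    (hu : Function.support u ⊆ tsupport φ) : ∫ x in Ω, u x ^ 2 ∂μ = ∫ x, u x ^ 2 ∂μ := by
  refine setIntegral_eq_integral_of_forall_compl_eq_zero fun x hx => ?_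
  have : u x = 0 := by
    by_contra h
    exact hx (hφ (hu h))
  simp [this]

/-- The local `L²` estimate behind the embedding of `W_0^{m,2}` into the exponential Orlicz class in
the critical dimension `N = 2m`. -/
theorem exists_sqrt_setIntegral_sq_le {m N : ℕ} (hm : 1 ≤ m) (hN : N = 2 * m)
    {Ω : Set (EuclideanSpace ℝ (Fin N))} (hΩo : IsOpen Ω) (hΩb : Bornology.IsBounded Ω) :
    ∃ K : ℝ, 0 < K ∧ ∀ φ : EuclideanSpace ℝ (Fin N) → ℝ, ContDiff ℝ m φ → HasCompactSupport φ →
      tsupport φ ⊆ Ω → ∀ E, MeasurableSet E → 0 < volume.real E → volume E ≠ ⊤ →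
      √(∫ x in E, φ x ^ 2)
        ≤ K * √(volume.real E * (1 + Real.log (1 + (volume.real E)⁻¹)))
          * ∑ i, √(∫ x in Ω, partialDeriv (Pi.single i m) φ x ^ 2) := by
  have hV : Module.finrank ℝ (EuclideanSpace ℝ (Fin N)) = 2 * m := by simp [hN]
  set w : ℝ := volume.real Ω with hw
  set κ : ℝ := (volume : Measure (EuclideanSpace ℝ (Fin N))).real (Metric.ball 0 1) with hκ
  have hw0 : 0 ≤ w := measureReal_nonneg
  have hκ0 : 0 ≤ κ := measureReal_nonneg
  have hwκ : 0 ≤ w * κ := mul_nonneg hw0 hκ0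
  -- So small that `|Ω|` times the volume of the `δ`-ball is at most `1/2`, which permits the
  -- absorption in `hPoin`.
  set δ : ℝ := 1 / (2 * (w * κ + 1)) with hδdef
  have hδ : 0 < δ := by positivity
  have hδ1 : δ ≤ 1 := by
    rw [hδdef, div_le_one (by positivity)]
    linarith
  set b : ℝ := (volume : Measure (EuclideanSpace ℝ (Fin N))).real (Metric.ball 0 δ) with hb
  have hb0 : 0 ≤ b := measureReal_nonneg
  have hwb : w * b ≤ 1 / 2 := by
    have h1 : b = δ ^ (2 * m) * κ := by
      rw [hb, measureReal_def, Measure.addHaar_ball_of_pos _ _ hδ, hV, ENNReal.toReal_mul,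
        ENNReal.toReal_ofReal (by positivity), hκ, measureReal_def]
    have h2 : δ ^ (2 * m) ≤ δ := pow_le_of_le_one hδ.le hδ1 (by omega)
    calc w * b = δ ^ (2 * m) * (w * κ) := by rw [h1]; ring
      _ ≤ δ * (w * κ + 1) := by gcongr; linarith
      _ = 1 / 2 := by rw [hδdef]; field_simp
  set c : ℝ := (2 * m : ℕ) * κ with hc
  have hc0 : 0 ≤ c := by positivity
  -- The three terms come from the inner ball, the annulus and the high frequencies.
  set K₀ : ℝ := 2 * √w * (δ ^ m)⁻¹ * b + √c + (δ ^ m)⁻¹ with hK₀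
  have hK₀pos : 0 < K₀ := by positivity
  have hNpos : 0 < N := by omega
  refine ⟨K₀ * √((N : ℝ) ^ m), by positivity, ?_⟩
  intro φ hφ hφc hφΩ E hE hEpos hEf
  set F := 𝓕 (fun x => (φ x : ℂ)) with hF
  have hφL := integrable_and_memLp_ofReal (μ := volume) hφ.continuous hφc
  obtain ⟨hFm, hA⟩ := memLp_norm_pow_mul_fourier hNpos hφ hφc
  set A : ℝ := √(∫ ξ, (‖ξ‖ ^ m * ‖F ξ‖) ^ 2) with hAdef
  have hA0 : 0 ≤ A := Real.sqrt_nonneg _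
  have hFc : Continuous F := continuous_fourier hφL.1
  have hnorm : ∀ s : Set (EuclideanSpace ℝ (Fin N)),
      ∫ x in s, ‖(φ x : ℂ)‖ ^ 2 = ∫ x in s, φ x ^ 2 := by
    intro s
    simp
  set X : ℝ := √(∫ x in Ω, φ x ^ 2) with hX
  have hX0 : 0 ≤ X := Real.sqrt_nonneg _
  set M : ℝ := ∫ x, ‖(φ x : ℂ)‖ with hM
  have hMX : M ≤ √w * X := by
    have h := setIntegral_le_sqrt_mul_sqrt hΩb.measure_lt_top.ne
      (fun x => norm_nonneg ((φ x : ℂ))) (hφL.2.restrict Ω).norm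
    rw [hnorm] at h
    refine le_trans (le_of_eq ?_) h
    refine (setIntegral_eq_integral_of_forall_compl_eq_zero fun x hx => ?_).symm
    have : φ x = 0 := image_eq_zero_of_notMem_tsupport fun h => hx (hφΩ h)
    simp [this]
  have hlow : ∀ R, δ ≤ R → ∫ ξ in Metric.ball 0 R, ‖F ξ‖
      ≤ M * b + √(c * Real.log (R / δ)) * A := fun R hR =>
    setIntegral_ball_norm_le hm hV hFc (norm_fourier_le _) hFm hδ hR
  -- Poincaré's inequality: take `E = Ω` and `R = δ`, so that the annulus is empty. The
  -- low-frequency term is then at most `X/2` and is absorbed on the left.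
  have hPoin : X ≤ 2 * (δ ^ m)⁻¹ * A := by
    have h1 := sqrt_setIntegral_sq_le hφL.1 hφL.2 hFm hΩo.measurableSet hΩb.measure_lt_top.ne hδ
    rw [hnorm] at h1
    have h2 := hlow δ le_rfl
    rw [div_self hδ.ne', Real.log_one, mul_zero, Real.sqrt_zero, zero_mul, add_zero] at h2
    have h3 : X ≤ √w * (M * b) + (δ ^ m)⁻¹ * A :=
      h1.trans (add_le_add (mul_le_mul_of_nonneg_left h2 (Real.sqrt_nonneg _)) le_rfl)
    have h4 : √w * (M * b) ≤ 1 / 2 * X := by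
      calc √w * (M * b) ≤ √w * (√w * X * b) := by gcongr
        _ = (√w * √w) * b * X := by ring
        _ = w * b * X := by rw [Real.mul_self_sqrt hw0]
        _ ≤ 1 / 2 * X := by gcongr
    linarith
  set t : ℝ := volume.real E with ht
  set L : ℝ := Real.log (1 + t⁻¹) with hL
  have ht1 : 1 ≤ 1 + t⁻¹ := by have := inv_pos.2 hEpos; linarith
  have hL0 : 0 ≤ L := Real.log_nonneg ht1
  -- With `R = δρ` the high-frequency factor `ρ^{-m}` is at most `√t` and `log (R/δ)` is at most
  -- `L`. The summand `1` ensures `R ≥ δ` for large `t` too.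
  set ρ : ℝ := (1 + t⁻¹) ^ ((2 * m : ℕ) : ℝ)⁻¹ with hρ
  have hρ1 : 1 ≤ ρ := Real.one_le_rpow ht1 (by positivity)
  have hρpow : (ρ ^ m) ^ 2 = 1 + t⁻¹ := by
    rw [← pow_mul, mul_comm m 2]
    exact Real.rpow_inv_natCast_pow (by positivity) (by omega)
  have hρm : (ρ ^ m)⁻¹ ≤ √t := by
    refine Real.le_sqrt_of_sq_le ?_
    rw [inv_pow, hρpow]
    refine inv_le_of_inv_le₀ hEpos ?_
    linarith
  have hρlog : Real.log ρ ≤ L := by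
    rw [hρ, Real.log_rpow (by positivity)]
    refine mul_le_of_le_one_left hL0 (inv_le_one_of_one_le₀ ?_)
    exact_mod_cast (by omega : 1 ≤ 2 * m)
  have h1 := sqrt_setIntegral_sq_le hφL.1 hφL.2 hFm hE hEf (R := δ * ρ) (by positivity)
  rw [hnorm] at h1
  have h2 := hlow (δ * ρ) (le_mul_of_one_le_right hδ.le hρ1)
  rw [mul_div_cancel_left₀ _ hδ.ne'] at h2
  have hsq1 : (1 : ℝ) ≤ √(1 + L) := Real.one_le_sqrt.2 (by linarith)
  have h3 : √(∫ x in E, φ x ^ 2) ≤ K₀ * √(t * (1 + L)) * A := by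
    have e1 : M * b ≤ 2 * √w * (δ ^ m)⁻¹ * b * A := by
      calc M * b ≤ √w * (2 * (δ ^ m)⁻¹ * A) * b := by
            gcongr
            exact hMX.trans (by gcongr)
        _ = _ := by ring
    have e2 : √(c * Real.log ρ) ≤ √c * √(1 + L) := by
      rw [← Real.sqrt_mul hc0]
      exact Real.sqrt_le_sqrt (mul_le_mul_of_nonneg_left (by linarith) hc0)
    have e3 : ((δ * ρ) ^ m)⁻¹ ≤ (δ ^ m)⁻¹ * √t := by
      rw [mul_pow, mul_inv]
      gcongr
    have hst : 0 ≤ √t := Real.sqrt_nonneg t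
    calc √(∫ x in E, φ x ^ 2)
        ≤ √t * (2 * √w * (δ ^ m)⁻¹ * b * A + √c * √(1 + L) * A) + (δ ^ m)⁻¹ * √t * A := by
          refine h1.trans (add_le_add (mul_le_mul_of_nonneg_left (h2.trans ?_) hst) ?_)
          · exact add_le_add e1 (mul_le_mul_of_nonneg_right e2 hA0)
          · exact mul_le_mul_of_nonneg_right e3 hA0
      _ = √t * A * (2 * √w * (δ ^ m)⁻¹ * b * 1 + √c * √(1 + L) + (δ ^ m)⁻¹ * 1) := by ring
      _ ≤ √t * A * (2 * √w * (δ ^ m)⁻¹ * b * √(1 + L) + √c * √(1 + L)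
          + (δ ^ m)⁻¹ * √(1 + L)) := by gcongr
      _ = K₀ * (√t * √(1 + L)) * A := by rw [hK₀]; ring
      _ = K₀ * √(t * (1 + L)) * A := by rw [Real.sqrt_mul hEpos.le]
  refine h3.trans ?_
  simp only [setIntegral_eq_integral_of_tsupport_subset hφΩ (support_partialDeriv_subset _ φ)]
  calc K₀ * √(t * (1 + L)) * A ≤ K₀ * √(t * (1 + L))
        * (√((N : ℝ) ^ m) * ∑ i, √(∫ x, partialDeriv (Pi.single i m) φ x ^ 2)) := by gcongr
    _ = _ := by ring

/-! ### Weak derivatives -/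

theorem integral_mul_sub_of_tsupport_subset {V : Type*} [NormedAddCommGroup V]
    [MeasurableSpace V] [BorelSpace V] {μ : Measure V} {Ω : Set V}
    {g g' φ : V → ℝ} (hg : LocallyIntegrableOn g Ω μ) (hg' : LocallyIntegrableOn g' Ω μ)
    (hφ : Continuous φ) (hφc : HasCompactSupport φ) (hφΩ : tsupport φ ⊆ Ω) :
    ∫ x, φ x • (g x - g' x) ∂μ = ∫ x in Ω, g x * φ x ∂μ - ∫ x in Ω, g' x * φ x ∂μ := by
  have hint : ∀ f : V → ℝ, LocallyIntegrableOn f Ω μ →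
      IntegrableOn (fun x => f x * φ x) Ω μ := by
    intro f hf
    have h1 : IntegrableOn (fun x => f x * φ x) (tsupport φ) μ :=
      (hf.integrableOn_compact_subset hφΩ hφc).mul_continuousOn hφ.continuousOn hφc
    have h2 := (integrableOn_iff_integrable_of_support_subset
      ((Function.support_mul_subset_right f φ).trans (subset_tsupport φ))).1 h1
    exact h2.integrableOn
  rw [← integral_sub (hint g hg) (hint g' hg')]
  rw [← setIntegral_eq_integral_of_forall_compl_eq_zero (s := Ω)]
  · congr 1
    ext x
    simp only [smul_eq_mul]
    ring
  · intro x hx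
    have : φ x = 0 := image_eq_zero_of_notMem_tsupport fun h => hx (hφΩ h)
    simp [this]

/-- This is the fundamental lemma of the calculus of variations. As `weakDeriv` is an arbitrary
choice, its properties are transferred from a known weak derivative through this uniqueness. -/
theorem HasWeakDeriv.ae_eq {N : ℕ} {Ω : Set (EuclideanSpace ℝ (Fin N))} (hΩ : IsOpen Ω)
    {β : Fin N → ℕ} {v g g' : EuclideanSpace ℝ (Fin N) → ℝ} (h : HasWeakDeriv Ω β v g)
    (h' : HasWeakDeriv Ω β v g') : g =ᵐ[volume.restrict Ω] g' := by
  have key := hΩ.ae_eq_zero_of_integral_contDiff_smul_eq_zero (μ := volume)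
    (f := fun x => g x - g' x) (h.2.1.sub h'.2.1) fun φ hφ hφc hφΩ => by
      rw [integral_mul_sub_of_tsupport_subset h.2.1 h'.2.1 hφ.continuous hφc hφΩ]
      have e := (h.2.2 φ hφ hφc hφΩ).symm.trans (h'.2.2 φ hφ hφc hφΩ)
      rw [mul_right_inj' (pow_ne_zero _ (by norm_num))] at e
      rw [e, sub_self]
  rw [Filter.EventuallyEq, ae_restrict_iff' hΩ.measurableSet]
  filter_upwards [key] with x hx hxΩ
  exact sub_eq_zero.1 (hx hxΩ)

theorem HasWeakDeriv.weakDeriv {N : ℕ} {Ω : Set (EuclideanSpace ℝ (Fin N))} {β : Fin N → ℕ}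
    {v g : EuclideanSpace ℝ (Fin N) → ℝ} (h : HasWeakDeriv Ω β v g) :
    HasWeakDeriv Ω β v (weakDeriv Ω β v) := by
  have hex : ∃ g, HasWeakDeriv Ω β v g := ⟨g, h⟩
  rw [FiniteExtinction.weakDeriv, dif_pos hex]
  exact hex.choose_spec

theorem MemSobolev.memLp_weakDeriv {N m : ℕ} {Ω : Set (EuclideanSpace ℝ (Fin N))}
    (hΩ : IsOpen Ω) {v : EuclideanSpace ℝ (Fin N) → ℝ} (hv : MemSobolev m Ω v) {β : Fin N → ℕ}
    (hβ : ∑ i, β i ≤ m) : MemLp (weakDeriv Ω β v) 2 (volume.restrict Ω) := by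
  obtain ⟨g, hg, hgL⟩ := hv.2 β hβ
  exact (memLp_congr_ae (hg.weakDeriv.ae_eq hΩ hg)).2 hgL

theorem partialDeriv_zero {N : ℕ} (φ : EuclideanSpace ℝ (Fin N) → ℝ) :
    partialDeriv (0 : Fin N → ℕ) φ = φ := by
  ext x
  have h : ∀ (n : ℕ) (d : Fin n → EuclideanSpace ℝ (Fin N)), n = 0 →
      iteratedFDeriv ℝ n φ x d = φ x := by
    rintro _ d rfl
    simp
  exact h _ _ (by simp)

theorem MemSobolev.weakDeriv_zero_ae_eq {N m : ℕ} {Ω : Set (EuclideanSpace ℝ (Fin N))}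
    (hΩ : IsOpen Ω) {v : EuclideanSpace ℝ (Fin N) → ℝ} (hv : MemSobolev m Ω v) :
    weakDeriv Ω 0 v =ᵐ[volume.restrict Ω] v := by
  obtain ⟨g, hg, -⟩ := hv.2 0 (by simp)
  refine hg.weakDeriv.ae_eq hΩ ⟨hg.1, hg.1, fun φ _ _ _ => ?_⟩
  simp [partialDeriv_zero]

theorem MemSobolev.integrable_gradSq {N m : ℕ} {Ω : Set (EuclideanSpace ℝ (Fin N))}
    (hΩ : IsOpen Ω) {v : EuclideanSpace ℝ (Fin N) → ℝ} (hv : MemSobolev m Ω v) :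
    IntegrableOn (gradSq m Ω v) Ω := by
  refine integrable_finsetSum _ fun β hβ => ?_
  exact (hv.memLp_weakDeriv hΩ (Finset.mem_piAntidiag.1 hβ).1.le).integrable_sq

theorem gradSq_nonneg {N m : ℕ} (Ω : Set (EuclideanSpace ℝ (Fin N)))
    (v : EuclideanSpace ℝ (Fin N) → ℝ) (x : EuclideanSpace ℝ (Fin N)) : 0 ≤ gradSq m Ω v x :=
  Finset.sum_nonneg fun _ _ => sq_nonneg _

theorem MemSobolev.integral_weakDeriv_single_sq_le {N m : ℕ}
    {Ω : Set (EuclideanSpace ℝ (Fin N))} (hΩ : IsOpen Ω) {v : EuclideanSpace ℝ (Fin N) → ℝ}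
    (hv : MemSobolev m Ω v) (i : Fin N) :
    ∫ x in Ω, weakDeriv Ω (Pi.single i m) v x ^ 2 ≤ ∫ x in Ω, gradSq m Ω v x := by
  refine integral_mono (hv.memLp_weakDeriv hΩ (by simp)).integrable_sq (hv.integrable_gradSq hΩ)
    fun x => ?_
  refine Finset.single_le_sum (f := fun β => weakDeriv Ω β v x ^ 2) (fun β _ => sq_nonneg _) ?_
  rw [Finset.mem_piAntidiag]
  simp

/-! ### From `C_c^m` to `W_0^{m,2}` -/

theorem sqrt_integral_sq_eq {X : Type*} [MeasurableSpace X] {μ : Measure X} {u : X → ℝ}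
    (hu : MemLp u 2 μ) : √(∫ x, u x ^ 2 ∂μ) = (eLpNorm u 2 μ).toReal := by
  rw [hu.eLpNorm_eq_integral_rpow_norm (by norm_num) (by norm_num),
    ENNReal.toReal_ofReal (Real.rpow_nonneg (integral_nonneg fun x => by positivity) _)]
  simp [Real.sqrt_eq_rpow]

theorem sqrt_integral_sq_le_add {X : Type*} [MeasurableSpace X] {μ : Measure X} {u w : X → ℝ}
    (hu : MemLp u 2 μ) (hw : MemLp w 2 μ) {ε : ℝ} (hε : 0 ≤ ε)
    (h : eLpNorm (fun x => u x - w x) 2 μ ≤ ENNReal.ofReal ε) :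
    √(∫ x, u x ^ 2 ∂μ) ≤ √(∫ x, w x ^ 2 ∂μ) + ε := by
  rw [sqrt_integral_sq_eq hu, sqrt_integral_sq_eq hw, ← ENNReal.toReal_ofReal hε,
    ← ENNReal.toReal_add hw.eLpNorm_ne_top ENNReal.ofReal_ne_top]
  refine ENNReal.toReal_mono (ENNReal.add_ne_top.2 ⟨hw.eLpNorm_ne_top, ENNReal.ofReal_ne_top⟩) ?_
  have h1 := eLpNorm_add_le hw.aestronglyMeasurable (hu.sub hw).aestronglyMeasurable
    (p := 2) (by norm_num)
  rw [add_sub_cancel] at h1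
  exact h1.trans (add_le_add le_rfl h)

/-- After square roots, both sides of the estimate for `C_c^m` functions are sums of `L²` norms, so
it survives passage to the closure; squaring happens only at the end. -/
theorem exists_setIntegral_sq_le_gradSq {m N : ℕ} (hm : 1 ≤ m) (hN : N = 2 * m)
    {Ω : Set (EuclideanSpace ℝ (Fin N))} (hΩo : IsOpen Ω) (hΩb : Bornology.IsBounded Ω) :
    ∃ K : ℝ, 0 < K ∧ ∀ v : EuclideanSpace ℝ (Fin N) → ℝ, MemSobolevZero m Ω v →
      ∀ E, MeasurableSet E → E ⊆ Ω → 0 < volume.real E →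
      ∫ x in E, v x ^ 2 ≤ K * (volume.real E * (1 + Real.log (1 + (volume.real E)⁻¹)))
        * ∫ x in Ω, gradSq m Ω v x := by
  obtain ⟨K, hK, hKφ⟩ := exists_sqrt_setIntegral_sq_le hm hN hΩo hΩb
  have hN0 : 0 < N := by omega
  refine ⟨(K * N) ^ 2, by positivity, ?_⟩
  intro v hv E hE hEΩ hEpos
  have hEf : volume E ≠ ⊤ := ((measure_mono hEΩ).trans_lt hΩb.measure_lt_top).ne
  set τ : ℝ := volume.real E * (1 + Real.log (1 + (volume.real E)⁻¹)) with hτ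
  have hτ0 : 0 ≤ τ := by
    have : 0 ≤ Real.log (1 + (volume.real E)⁻¹) :=
      Real.log_nonneg (by have := inv_pos.2 hEpos; linarith)
    positivity
  set D : ℝ := ∫ x in Ω, gradSq m Ω v x with hD
  have hD0 : 0 ≤ D := integral_nonneg fun x => gradSq_nonneg Ω v x
  set P : ℝ := K * √τ with hP
  have hP0 : 0 ≤ P := by positivity
  have hμ : volume.restrict E ≤ volume.restrict Ω := Measure.restrict_mono_set volume hEΩ
  have hmain : √(∫ x in E, v x ^ 2) ≤ P * (N * √D) := by
    refine le_of_forall_pos_le_add fun ε' hε' => ?_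
    -- Replacing `v` by `φ` costs `ε` on the left and `P * N * ε` through the `N` pure derivatives
    -- on the right.
    set ε : ℝ := ε' / (P * N + 1) with hεdef
    have hε : 0 < ε := by positivity
    obtain ⟨φ, hφ, hφc, hφΩ, hφε⟩ := hv.2 (ENNReal.ofReal ε) (ENNReal.ofReal_pos.2 hε)
    have hφL : MemLp φ 2 (volume.restrict E) := hφ.continuous.memLp_of_hasCompactSupport hφc
    have h0 : √(∫ x in E, v x ^ 2) ≤ √(∫ x in E, φ x ^ 2) + ε := by
      refine sqrt_integral_sq_le_add (hv.1.1.mono_measure hμ) hφL hε.le ?_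
      have h1 := hφε 0 (by simp)
      rw [partialDeriv_zero] at h1
      refine le_trans (eLpNorm_mono_measure _ hμ) (le_trans (le_of_eq (eLpNorm_congr_ae ?_)) h1.le)
      filter_upwards [hv.1.weakDeriv_zero_ae_eq hΩo] with x hx
      rw [hx]
    have hi : ∀ i, √(∫ x in Ω, partialDeriv (Pi.single i m) φ x ^ 2) ≤ √D + ε := by
      intro i
      have hβ : ∑ j, (Pi.single i m : Fin N → ℕ) j ≤ m := by simp
      have h1 := hφε (Pi.single i m) hβ
      have hpL : MemLp (partialDeriv (Pi.single i m) φ) 2 (volume.restrict Ω) :=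
        (continuous_partialDeriv hφ hβ).memLp_of_hasCompactSupport
          (hasCompactSupport_partialDeriv _ hφc)
      have h2 := sqrt_integral_sq_le_add hpL (hv.1.memLp_weakDeriv hΩo hβ) hε.le
        ((eLpNorm_sub_comm _ _ _ _).trans_le h1.le)
      exact h2.trans (add_le_add (Real.sqrt_le_sqrt
        (hv.1.integral_weakDeriv_single_sq_le hΩo i)) le_rfl)
    have h3 : √(∫ x in E, φ x ^ 2) ≤ P * (N * (√D + ε)) := by
      refine (hKφ φ hφ hφc hφΩ E hE hEpos hEf).trans ?_
      refine mul_le_mul_of_nonneg_left ?_ hP0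
      refine (Finset.sum_le_sum fun i _ => hi i).trans (le_of_eq ?_)
      rw [Finset.sum_const, Finset.card_univ, Fintype.card_fin, nsmul_eq_mul]
    calc √(∫ x in E, v x ^ 2) ≤ P * (N * (√D + ε)) + ε := h0.trans (add_le_add h3 le_rfl)
      _ = P * (N * √D) + (P * N + 1) * ε := by ring
      _ = P * (N * √D) + ε' := by rw [hεdef]; field_simp
  have hsq := (Real.sqrt_le_left (by positivity)).1 hmain
  calc ∫ x in E, v x ^ 2 ≤ (P * (N * √D)) ^ 2 := hsq
    _ = (K * N) ^ 2 * √τ ^ 2 * √D ^ 2 := by rw [hP]; ring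
    _ = _ := by rw [Real.sq_sqrt hτ0, Real.sq_sqrt hD0]

/-! ### The inverse of the Orlicz function -/

theorem orliczBhat_orliczBhatInv {y : ℝ} (hy : 0 ≤ y) :
    0 ≤ orliczBhatInv y ∧ orliczBhat (orliczBhatInv y) = y :=
  ⟨Function.invFunOn_mem (bijOn_orliczBhat.surjOn hy),
    Function.invFunOn_eq (bijOn_orliczBhat.surjOn hy)⟩

/-- With `S = B̂⁻¹(1/t)`, for large `S` the value `1/t` is of order `S ln S` and `ln(1 + 1/t)` of
order `ln S`, so the product of the left side with `S` stays bounded. For small `S` everything is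
bounded because `1/t ≥ 1/T`. -/
theorem exists_mul_log_le_inv_orliczBhatInv {T : ℝ} (hT : 0 < T) :
    ∃ C : ℝ, 0 < C ∧ ∀ t, 0 < t → t ≤ T →
      t * (1 + Real.log (1 + t⁻¹)) ≤ C * (orliczBhatInv t⁻¹)⁻¹ := by
  refine ⟨5 + 5 * Real.exp 2 * T, by positivity, ?_⟩
  intro t ht htT
  obtain ⟨hS0, hS⟩ := orliczBhat_orliczBhatInv (inv_pos.2 ht).le
  set S := orliczBhatInv t⁻¹
  set y := t⁻¹ with hy
  have hy0 : 0 < y := inv_pos.2 ht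
  have hSpos : 0 < S := by
    rcases hS0.eq_or_lt with h | h
    · rw [← h] at hS
      simp [orliczBhat] at hS
      exact absurd hS hy0.ne
    · exact h
  set l := Real.log (S + 1) with hl
  have hl0 : 0 ≤ l := Real.log_nonneg (by linarith)
  have hlS : l ≤ S := by
    have := Real.log_le_sub_one_of_pos (by linarith : 0 < S + 1)
    linarith
  have hyS : y = (S + 1) * l - S := hS.symm
  -- From `l ≤ S` one gets `y ≤ S²`, hence `1 + y ≤ (S + 1)²`.
  have hlog : Real.log (1 + y) ≤ 2 * l := by
    have h1 : Real.log ((S + 1) ^ 2) = 2 * l := by rw [Real.log_pow, hl]; norm_num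
    rw [← h1]
    refine Real.log_le_log (by linarith) ?_
    nlinarith
  have hkey : (1 + Real.log (1 + y)) * S ≤ (5 + 5 * Real.exp 2 * T) * y := by
    have hE : 0 ≤ 5 * Real.exp 2 * T * y := by positivity
    -- For `l ≥ 2`, `y ≥ S l / 2` and `1 + 2l ≤ 5l/2` give the constant `5`. For `l < 2`, `S ≤ e²`
    -- and `1 ≤ T y` give `5 e² T`.
    rcases le_or_gt 2 l with h | h
    · have h1 : S * l / 2 ≤ y := by nlinarith
      nlinarith
    · have h1 : S ≤ Real.exp 2 := by
        have := (Real.log_lt_iff_lt_exp (by linarith)).1 h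
        linarith
      have h2 : 1 ≤ T * y := by
        rw [hy, ← div_eq_mul_inv, one_le_div ht]
        exact htT
      calc (1 + Real.log (1 + y)) * S ≤ 5 * Real.exp 2 :=
            mul_le_mul (by linarith) h1 hS0 (by norm_num)
        _ ≤ 5 * Real.exp 2 * (T * y) := le_mul_of_one_le_right (by positivity) h2
        _ ≤ _ := by linarith
  have hty : t * y = 1 := mul_inv_cancel₀ ht.ne'
  rw [le_mul_inv_iff₀ hSpos]
  calc t * (1 + Real.log (1 + y)) * S = t * ((1 + Real.log (1 + y)) * S) := by ring
    _ ≤ t * ((5 + 5 * Real.exp 2 * T) * y) := mul_le_mul_of_nonneg_left hkey ht.le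
    _ = (5 + 5 * Real.exp 2 * T) * (t * y) := by ring
    _ = _ := by rw [hty, mul_one]

/-! ### The potential term -/

section Potential

variable {N : ℕ} {α q : ℝ} {Ω : Set (EuclideanSpace ℝ (Fin N))}
  {a v : EuclideanSpace ℝ (Fin N) → ℝ}

theorem aemeasurable_modifiedPotential (ha : AEMeasurable a (volume.restrict Ω)) :
    AEMeasurable (modifiedPotential α a) (volume.restrict Ω) := by
  have h : modifiedPotential α a
      = ({0}ᶜ : Set (EuclideanSpace ℝ (Fin N))).indicator
        fun x => a x * Real.exp (-(1 / ‖x‖ ^ α)) := by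
    ext x
    by_cases hx : x = 0 <;> simp [modifiedPotential, hx]
  rw [h]
  refine AEMeasurable.indicator (ha.mul ?_) (measurableSet_singleton 0).compl
  exact (by fun_prop : Measurable fun x : EuclideanSpace ℝ (Fin N) =>
    Real.exp (-(1 / ‖x‖ ^ α))).aemeasurable

theorem modifiedPotential_nonneg {x : EuclideanSpace ℝ (Fin N)} (ha : 0 ≤ a x) :
    0 ≤ modifiedPotential α a x := by
  unfold modifiedPotential
  split_ifs
  · exact le_rfl
  · positivity

theorem modifiedPotential_le {x : EuclideanSpace ℝ (Fin N)} (ha : 0 ≤ a x) :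
    modifiedPotential α a x ≤ a x := by
  unfold modifiedPotential
  split_ifs
  · exact ha
  · refine mul_le_of_le_one_right ha (Real.exp_le_one_iff.2 (neg_nonpos.2 ?_))
    positivity

theorem rpow_one_add_le_one_add_sq {y : ℝ} (hy : 0 ≤ y) (hq0 : 0 < q) (hq1 : q < 1) :
    y ^ (1 + q) ≤ 1 + y ^ 2 := by
  rcases le_or_gt y 1 with h | h
  · have := Real.rpow_le_one hy h (by linarith : 0 ≤ 1 + q)
    nlinarith [sq_nonneg y]
  · have h1 : y ^ (1 + q) ≤ y ^ (2 : ℝ) := Real.rpow_le_rpow_of_exponent_le h.le (by linarith)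
    rw [Real.rpow_two] at h1
    linarith

/-- Splitting `energy` into its two terms requires this, since the Bochner integral of a
non-integrable function is `0` by convention. The exponent `1 + q` lies below `2`, so `K(1 + v²)`
dominates. -/
theorem integrable_potential_mul_rpow (hΩm : MeasurableSet Ω) (hΩf : volume Ω ≠ ⊤) (hq0 : 0 < q)
    (hq1 : q < 1) {b : EuclideanSpace ℝ (Fin N) → ℝ} (hb : AEMeasurable b (volume.restrict Ω))
    (hb0 : ∀ x ∈ Ω, 0 ≤ b x) {K : ℝ} (hbK : ∀ x ∈ Ω, b x ≤ K)
    (hv : MemLp v 2 (volume.restrict Ω)) :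
    IntegrableOn (fun x => b x * |v x| ^ (1 + q)) Ω := by
  have hdom : IntegrableOn (fun x => K * (1 + v x ^ 2)) Ω :=
    ((integrableOn_const hΩf).add hv.integrable_sq).const_mul K
  refine hdom.mono' (hb.mul (hv.aestronglyMeasurable.aemeasurable.abs.pow_const _)
    ).aestronglyMeasurable ?_
  refine (ae_restrict_iff' hΩm).2 (Eventually.of_forall fun x hx => ?_)
  have h0 := hb0 x hx
  have h1 : 0 ≤ |v x| ^ (1 + q) := Real.rpow_nonneg (abs_nonneg _) _
  rw [Real.norm_of_nonneg (mul_nonneg h0 h1)]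
  have h2 := rpow_one_add_le_one_add_sq (abs_nonneg (v x)) hq0 hq1
  rw [sq_abs] at h2
  exact mul_le_mul (hbK x hx) h2 h1 (h0.trans (hbK x hx))

end Potential

/-- Where the potential exceeds `c |v|^{1-q}` it controls `c v²`, so that an energy at most `c h`
forces the gradient term below `c` times the mass of `v` on the complementary set. -/
theorem integral_gradSq_le_of_energy_le {N m : ℕ} {q : ℝ}
    {Ω : Set (EuclideanSpace ℝ (Fin N))} {b v : EuclideanSpace ℝ (Fin N) → ℝ} (hΩ : IsOpen Ω)
    (hb0 : ∀ x ∈ Ω, 0 ≤ b x) (hv : MemSobolev m Ω v)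
    (hbv : IntegrableOn (fun x => b x * |v x| ^ (1 + q)) Ω) {c : ℝ}
    {E : Set (EuclideanSpace ℝ (Fin N))} (hE : MeasurableSet E) (hEΩ : E ⊆ Ω)
    (hEae : E =ᵐ[volume] {x ∈ Ω | b x ≤ |v x| ^ (1 - q) * c})
    (henergy : energy m q Ω b v ≤ c * ∫ x in Ω, v x ^ 2) :
    ∫ x in Ω, gradSq m Ω v x ≤ c * ∫ x in E, v x ^ 2 := by
  have hsq : IntegrableOn (fun x => v x ^ 2) Ω := hv.1.integrable_sq
  rw [energy, integral_add (hv.integrable_gradSq hΩ) hbv] at henergy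
  have hsplit : ∫ x in Ω, v x ^ 2 = (∫ x in E, v x ^ 2) + ∫ x in Ω \ E, v x ^ 2 := by
    rw [← setIntegral_union disjoint_sdiff_right (hΩ.measurableSet.diff hE) (hsq.mono_set hEΩ)
      (hsq.mono_set sdiff_subset), union_sdiff_cancel hEΩ]
  have hcompl : c * ∫ x in Ω \ E, v x ^ 2 ≤ ∫ x in Ω, b x * |v x| ^ (1 + q) := by
    have hnn : 0 ≤ᵐ[volume.restrict Ω] fun x => b x * |v x| ^ (1 + q) :=
      (ae_restrict_iff' hΩ.measurableSet).2 (Eventually.of_forall fun x hx =>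
        mul_nonneg (hb0 x hx) (Real.rpow_nonneg (abs_nonneg _) _))
    refine le_trans ?_ (setIntegral_mono_set hbv hnn
      (Eventually.of_forall (sdiff_subset : Ω \ E ⊆ Ω)))
    rw [← integral_const_mul]
    refine setIntegral_mono_on_ae ((hsq.mono_set sdiff_subset).const_mul c)
      (hbv.mono_set sdiff_subset) (hΩ.measurableSet.diff hE) ?_
    filter_upwards [hEae] with x hx hxE
    have hxE' : ¬ (x ∈ Ω ∧ b x ≤ |v x| ^ (1 - q) * c) := fun h => hxE.2 (hx.mpr h)
    have hlt : |v x| ^ (1 - q) * c ≤ b x := (not_le.1 fun h => hxE' ⟨hxE.1, h⟩).le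
    -- Zeros of `v` are harmless here: the exponents add up to `2 ≠ 0`.
    have hpow : v x ^ 2 = |v x| ^ (1 - q) * |v x| ^ (1 + q) := by
      rw [← Real.rpow_add' (abs_nonneg _) (by norm_num)]
      rw [show (1 - q) + (1 + q) = (2 : ℝ) by ring, Real.rpow_two, sq_abs]
    calc c * v x ^ 2 = |v x| ^ (1 - q) * c * |v x| ^ (1 + q) := by rw [hpow]; ring
      _ ≤ b x * |v x| ^ (1 + q) :=
        mul_le_mul_of_nonneg_right hlt (Real.rpow_nonneg (abs_nonneg _) _)
  rw [hsplit, mul_add] at henergy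
  linarith

end FiniteExtinction

/-! ### The lower bound for almost-minimizers -/

theorem proposition2p3 {m N : ℕ} (hm : 1 ≤ m) (hN : N = 2 * m)
    {q : ℝ} (hq0 : 0 < q) (hq1 : q < 1) {α : ℝ} (hα : 0 < α)
    {Ω : Set (EuclideanSpace ℝ (Fin N))} (hΩo : IsOpen Ω) (hΩc : IsConnected Ω)
    (hΩb : Bornology.IsBounded Ω) (hΩ0 : (0 : EuclideanSpace ℝ (Fin N)) ∈ Ω)
    {a : EuclideanSpace ℝ (Fin N) → ℝ} (ha_meas : AEMeasurable a (volume.restrict Ω))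
    (ha_nonneg : ∀ x ∈ Ω, 0 ≤ a x) (ha_bdd : ∃ K : ℝ, ∀ x ∈ Ω, a x ≤ K)
    (ha_dini : LogDiniCondition Ω a) :
    ∃ C : ℝ, 0 < C ∧ ∀ᶠ h in 𝓝[>] (0 : ℝ),
      ∀ v : EuclideanSpace ℝ (Fin N) → ℝ,
        IsAlmostMinimizer m q Ω (modifiedPotential α a) h v →
        C ≤ firstEigenvalue m q Ω (modifiedPotential α a) h / h *
          (orliczBhatInv
            (volume.real {x ∈ Ω | modifiedPotential α a x ≤
              |v x| ^ (1 - q) *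
                (2 * firstEigenvalue m q Ω (modifiedPotential α a) h / h)})⁻¹)⁻¹ := by
  obtain ⟨Ka, hKa⟩ := ha_bdd
  have hΩf : volume Ω ≠ ⊤ := hΩb.measure_lt_top.ne
  have hΩpos : 0 < volume.real Ω :=
    ENNReal.toReal_pos (hΩo.measure_pos volume ⟨0, hΩ0⟩).ne' hΩf
  obtain ⟨K, hK, hKv⟩ := exists_setIntegral_sq_le_gradSq hm hN hΩo hΩb
  obtain ⟨C, hC, hCt⟩ := exists_mul_log_le_inv_orliczBhatInv hΩpos
  -- The final inequality is `1 ≤ c K C Y` with `c = 2 * lam / h`.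
  refine ⟨(2 * K * C)⁻¹, by positivity, ?_⟩
  filter_upwards [self_mem_nhdsWithin] with h hh v hv
  have hh0 : 0 < h := hh
  set b := modifiedPotential α a with hb
  set lam := firstEigenvalue m q Ω b h with hlam
  set c : ℝ := 2 * lam / h with hc
  have hbm : AEMeasurable b (volume.restrict Ω) := aemeasurable_modifiedPotential ha_meas
  have hb0 : ∀ x ∈ Ω, 0 ≤ b x := fun x hx => modifiedPotential_nonneg (ha_nonneg x hx)
  have hbv := integrable_potential_mul_rpow hΩo.measurableSet hΩf hq0 hq1 hbm hb0
    (fun x hx => (modifiedPotential_le (ha_nonneg x hx)).trans (hKa x hx)) hv.mem.1.1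
  set s : Set (EuclideanSpace ℝ (Fin N)) := {x ∈ Ω | b x ≤ |v x| ^ (1 - q) * c} with hs
  have hsm : NullMeasurableSet s volume := by
    have h1 : NullMeasurableSet {x | b x ≤ |v x| ^ (1 - q) * c} (volume.restrict Ω) :=
      nullMeasurableSet_le hbm
        ((hv.mem.1.1.aestronglyMeasurable.aemeasurable.abs.pow_const _).mul_const c)
    have h2 := (nullMeasurableSet_restrict hΩo.measurableSet.nullMeasurableSet).1 h1
    rw [inter_comm] at h2
    exact h2
  -- `v` and `a` are only a.e. measurable, so the sublevel set is replaced by a measurable subset of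
  -- the same measure.
  obtain ⟨E, hEs, hEm, hEae⟩ := hsm.exists_measurable_subset_ae_eq
  have hEΩ : E ⊆ Ω := hEs.trans fun x hx => hx.1
  set D : ℝ := ∫ x in Ω, gradSq m Ω v x with hD
  have hD0 : 0 ≤ D := integral_nonneg fun x => gradSq_nonneg Ω v x
  have hDE : D ≤ c * ∫ x in E, v x ^ 2 := by
    refine integral_gradSq_le_of_energy_le hΩo hb0 hv.mem.1 hbv hEm hEΩ hEae ?_
    rw [hv.normSq_eq, hc, div_mul_cancel₀ _ hh0.ne']
    exact hv.energy_le
  have hlam0 : 0 ≤ lam := by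
    have h1 : 0 ≤ energy m q Ω b v :=
      setIntegral_nonneg hΩo.measurableSet fun x hx => add_nonneg (gradSq_nonneg Ω v x)
        (mul_nonneg (hb0 x hx) (Real.rpow_nonneg (abs_nonneg _) _))
    linarith [hv.energy_le]
  have hc0 : 0 ≤ c := by positivity
  -- With `E = Ω` the embedding is Poincaré's inequality, so `D = 0` would force `h ≤ 0`. Positivity
  -- of `D` in turn forces `E` to have positive measure, and it allows the final cancellation.
  have hDpos : 0 < D := by
    refine hD0.lt_of_ne fun hD' => ?_
    have h1 := hKv v hv.mem Ω hΩo.measurableSet Subset.rfl hΩpos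
    rw [hv.normSq_eq, ← hD, ← hD', mul_zero] at h1
    exact absurd h1 (not_le.2 hh0)
  have ht : volume.real E = volume.real s := measureReal_congr hEae
  have hEpos : 0 < volume.real E := by
    refine measureReal_nonneg.lt_of_ne fun h0 => ?_
    have hE0 : volume E = 0 :=
      (measureReal_eq_zero_iff ((measure_mono hEΩ).trans_lt hΩb.measure_lt_top).ne).1 h0.symm
    rw [setIntegral_measure_zero _ hE0, mul_zero] at hDE
    exact absurd hDE (not_le.2 hDpos)
  have h1 := hKv v hv.mem E hEm hEΩ hEpos
  have h2 := hCt _ hEpos (measureReal_mono hEΩ hΩf)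
  rw [← ht]
  set Y : ℝ := (orliczBhatInv (volume.real E)⁻¹)⁻¹ with hY
  have h3 : D ≤ (c * (K * (C * Y))) * D := by
    calc D ≤ c * ∫ x in E, v x ^ 2 := hDE
      _ ≤ c * (K * (C * Y) * D) := by
        refine mul_le_mul_of_nonneg_left (h1.trans ?_) hc0
        exact mul_le_mul_of_nonneg_right (mul_le_mul_of_nonneg_left h2 hK.le) hD0
      _ = _ := by ring
  have h4 : 1 ≤ c * (K * (C * Y)) := le_of_mul_le_mul_right (by simpa using h3) hDpos
  rw [inv_le_iff_one_le_mul₀ (by positivity)]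
  calc (1 : ℝ) ≤ c * (K * (C * Y)) := h4
    _ = lam / h * Y * (2 * K * C) := by rw [hc]; ring
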